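/- Let $K$ be a commutative ring with a derivation $\partial$, and let $C=K[A_n^{(s)},\varphi^{(s)} : n,s\in\mathbb Z_{\ge 0}]$ be the ring of differential polynomials in the variables $A_0,A_1,A_2,\dots$ and $\varphi$, with $\partial$ extended by $\partial(A_n^{(s)})=A_n^{(s+1)}$, $\partial(\varphi^{(s)})=\varphi^{(s+1)}$. Write $q_i$ for the variables. For $H\in C$ put $\frac{\delta H}{\delta q_i}=\sum_{s}(-\partial)^s\frac{\partial H}{\partial q_i^{(s)}}$. A matrix $B=(B_{ij})$ of differential operators over $C$, indexed by the variables, is called *Hamiltonian* if it is skew-adjoint, $B_{ij}^\dagger=-B_{ji}$, and if for all $H,F\in C$ $$X_{\{H,F\}}=[X_H,X_F],\qquad \{H,F\}=X_H(F),$$ where $X_H$ is the $K$-linear derivation of $C$ that commutes with $\partial$ and satisfies $X_H(q_i)=\sum_j B_{ij}\left(\frac{\delta H}{\delta q_j}\right)$. **Proposition.** For every constant $\alpha$ (that is, $\alpha\in K$ with $\partial\alpha=0$) the following two matrices are Hamiltonian. (a) The linear extension $\bar{\mathcal B}^{\mathcal H}$ of the KP matrix: for $n,m\ge 0$, $$\bar{\mathcal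 B}^{\mathcal H}_{nm}=\sum_{\mu\ge0}\left[\binom n\mu A_{n+m-\mu}\partial^\mu-(-\partial)^\mu\binom m\mu A_{n+m-\mu}\right],$$ $$\bar{\mathcal B}^{\mathcal H}_{\varphi m}=\alpha\sum_{s\ge0}(-\partial)^s\binom m{s+1}A_{m-1-s},\qquad \bar{\mathcal B}^{\mathcal H}_{n\varphi}=-\alpha\sum_{s\ge0}\binom n{s+1}A_{n-1-s}\,\partial^s,\qquad \bar{\mathcal B}^{\mathcal H}_{\varphi\varphi}=0.$$ (b) The linear extension $\mathcal B^{\mathcal H}$ of the Benney matrix: for $n,m\ge 0$, $$\mathcal B^{\mathcal H}_{nm}=nA_{n+m-1}\partial+\partial\, mA_{n+m-1},\qquad \mathcal B^{\mathcal H}_{\varphi m}=\alpha mA_{m-1},\qquad \mathcal B^{\mathcal H}_{n\varphi}=-\alpha nA_{n-1},\qquad \mathcal B^{\mathcal H}_{\varphi\varphi}=0.$$ (Terms with a zero coefficient are read as $0$.) -/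

import Mathlib

open scoped Differential

noncomputable section

namespace DarkEq

/-- The differential polynomials `K[q_i^{(n)} : i ∈ I, n ≥ 0]` in the variables `q_i` over `K`;
the jet variable `q_i^{(n)}` is `MvPolynomial.X (i, n)`. -/
abbrev JetRing (I K : Type*) [CommRing K] : Type _ := MvPolynomial (I × ℕ) K

section Jets

variable {I K : Type*} [CommRing K] [Differential K]

/-- Differentiation of the coefficients of a polynomial. -/
def coeffFun {σ : Type*} (f : MvPolynomial σ K) : MvPolynomial σ K :=
  ∑ m ∈ f.support, MvPolynomial.monomial m (MvPolynomial.coeff m f)′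

theorem coeff_coeffFun {σ : Type*} (f : MvPolynomial σ K) (m : σ →₀ ℕ) :
    MvPolynomial.coeff m (coeffFun f) = (MvPolynomial.coeff m f)′ := by
  classical
  rw [coeffFun, MvPolynomial.coeff_sum]
  simp only [MvPolynomial.coeff_monomial]
  rw [Finset.sum_ite_eq']
  split_ifs with h
  · rfl
  · rw [MvPolynomial.notMem_support_iff.mp h, map_zero]

/-- Differentiation of the coefficients, as a derivation. -/
def coeffDeriv (σ K : Type*) [CommRing K] [Differential K] :
    Derivation ℤ (MvPolynomial σ K) (MvPolynomial σ K) :=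
  Derivation.mk'
    (AddMonoidHom.toIntLinearMap
      { toFun := coeffFun
        map_zero' := by
          ext m
          simp [coeff_coeffFun]
        map_add' := fun f g => by
          ext m
          simp [coeff_coeffFun] })
    (fun f g => by
      classical
      ext m
      change MvPolynomial.coeff m (coeffFun (f * g)) =
        MvPolynomial.coeff m (f * coeffFun g + g * coeffFun f)
      rw [coeff_coeffFun, mul_comm g, MvPolynomial.coeff_add, MvPolynomial.coeff_mul,
        MvPolynomial.coeff_mul, MvPolynomial.coeff_mul, map_sum, ← Finset.sum_add_distrib]
      refine Finset.sum_congr rfl fun p _ => ?_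
      rw [coeff_coeffFun, coeff_coeffFun, Derivation.leibniz, smul_eq_mul, smul_eq_mul]
      ring)

/-- The total derivative `∂` of the ring of differential polynomials: the derivation that extends
the one of `K` and sends `q_i^{(n)}` to `q_i^{(n+1)}`. -/
def totalDeriv (I K : Type*) [CommRing K] [Differential K] :
    Derivation ℤ (JetRing I K) (JetRing I K) :=
  coeffDeriv (I × ℕ) K +
    (MvPolynomial.mkDerivation K
      (fun p : I × ℕ => (MvPolynomial.X (p.1, p.2 + 1) : JetRing I K))).restrictScalars ℤ

theorem totalDeriv_C (c : K) :
    totalDeriv I K (MvPolynomial.C c) = MvPolynomial.C c′ := by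
  have h : coeffDeriv (I × ℕ) K (MvPolynomial.C c) = MvPolynomial.C c′ := by
    classical
    ext m
    change MvPolynomial.coeff m (coeffFun _) = _
    rw [coeff_coeffFun, MvPolynomial.coeff_C, MvPolynomial.coeff_C]
    split_ifs <;> simp
  simp [totalDeriv, h]

theorem totalDeriv_X (i : I) (n : ℕ) :
    totalDeriv I K (MvPolynomial.X (i, n)) = MvPolynomial.X (i, n + 1) := by
  have h : coeffDeriv (I × ℕ) K (MvPolynomial.X (i, n)) = 0 := by
    classical
    ext m
    change MvPolynomial.coeff m (coeffFun _) = _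
    rw [coeff_coeffFun, MvPolynomial.coeff_X, MvPolynomial.coeff_zero]
    split_ifs <;> simp
  simp [totalDeriv, h, MvPolynomial.mkDerivation_X]

/-- `f ∼ 0`: `f` is trivial (a divergence), i.e. `f` lies in the image of `∂`. -/
def IsDivergence (f : JetRing I K) : Prop := ∃ g : JetRing I K, totalDeriv I K g = f

/-- The ring of (scalar) differential operators with coefficients in the differential polynomials:
the subring of additive endomorphisms generated by `∂` and the multiplication operators. -/
def diffOps (I K : Type*) [CommRing K] [Differential K] :
    Subring (Module.End ℤ (JetRing I K)) :=
  Subring.closure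
    (insert (totalDeriv I K).toLinearMap (Set.range (LinearMap.mulLeft ℤ (A := JetRing I K))))

/-- A scalar differential operator; the product is the composition. -/
def DiffOp (I K : Type*) [CommRing K] [Differential K] : Type _ := diffOps I K

instance (I K : Type*) [CommRing K] [Differential K] : Ring (DiffOp I K) :=
  inferInstanceAs (Ring (diffOps I K))

/-- The action of differential operators on differential polynomials. -/
def DiffOp.act : DiffOp I K →+* Module.End ℤ (JetRing I K) := (diffOps I K).subtype

/-- The differential operator `∂`. -/
def dOp (I K : Type*) [CommRing K] [Differential K] : DiffOp I K :=
  ⟨(totalDeriv I K).toLinearMap, Subring.subset_closure (Set.mem_insert _ _)⟩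

/-- The operator of multiplication by `f`. -/
def mulOp (f : JetRing I K) : DiffOp I K :=
  ⟨LinearMap.mulLeft ℤ f, Subring.subset_closure (Set.mem_insert_of_mem _ ⟨f, rfl⟩)⟩

theorem dOp_apply (f : JetRing I K) : (dOp I K).act f = totalDeriv I K f := rfl

theorem mulOp_apply (f g : JetRing I K) : (mulOp f).act g = f * g := rfl

/-- `Q` is the formal adjoint `P†` of `P`: `f P(g) ∼ P†(f) g` for all `f`, `g`. -/
def IsAdjoint (P Q : DiffOp I K) : Prop :=
  ∀ f g : JetRing I K, IsDivergence (f * P.act g - Q.act f * g)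

/-- The variational derivative `δH/δq_i = ∑_n (-∂)^n (∂H/∂q_i^{(n)})`. -/
def varDeriv (H : JetRing I K) (i : I) : JetRing I K :=
  ∑ᶠ n : ℕ, ((-dOp I K) ^ n).act (MvPolynomial.pderiv (i, n) H)

/-- The sum that defines `varDeriv` is finite. -/
theorem varDeriv_support_finite (H : JetRing I K) (i : I) :
    (Function.support fun n : ℕ =>
      ((-dOp I K) ^ n).act (MvPolynomial.pderiv (i, n) H)).Finite := by
  classical
  refine (H.vars.image Prod.snd).finite_toSet.subset fun n hn => ?_
  by_contra h
  refine hn ?_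
  have : (i, n) ∉ H.vars := fun h' => h (Finset.mem_coe.2 (Finset.mem_image.2 ⟨_, h', rfl⟩))
  simp only [MvPolynomial.pderiv_eq_zero_of_notMem_vars this, map_zero]

/-- Only finitely many variational derivatives of `H` are nonzero. -/
theorem varDeriv_finite (H : JetRing I K) : (Function.support (varDeriv H)).Finite := by
  classical
  refine (H.vars.image Prod.fst).finite_toSet.subset fun i hi => ?_
  by_contra h
  refine hi ?_
  have : ∀ n, (i, n) ∉ H.vars := fun n h' =>
    h (Finset.mem_coe.2 (Finset.mem_image.2 ⟨_, h', rfl⟩))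
  simp only [varDeriv, MvPolynomial.pderiv_eq_zero_of_notMem_vars (this _), map_zero, finsum_zero]

/-- The evolution field with `q_i ↦ Y_i`: the derivation over `K` that commutes with `∂`,
so `q_i^{(n)} ↦ ∂^n (Y_i)`. -/
def evolField (Y : I → JetRing I K) : Derivation K (JetRing I K) (JetRing I K) :=
  MvPolynomial.mkDerivation K fun p : I × ℕ => (dOp I K ^ p.2).act (Y p.1)

/-- The Hamiltonian evolution field `X_H` of `B`, with motion equations
`q_{i,t} = ∑_j B_{ij}(δH/δq_j)`; the sum over `j` is finite by `varDeriv_finite`. -/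
def hamField (B : I → I → DiffOp I K) (H : JetRing I K) :
    Derivation K (JetRing I K) (JetRing I K) :=
  evolField fun i => ∑ᶠ j : I, (B i j).act (varDeriv H j)

/-- A matrix `B` of differential operators is Hamiltonian if it is skew-adjoint, `B† = -B`, and
`H ↦ X_H` satisfies `X_{{H, F}} = [X_H, X_F]` with the Poisson bracket `{H, F} = X_H(F)`,
for all Hamiltonians `H`, `F`. -/
structure IsHamiltonian (B : I → I → DiffOp I K) : Prop where
  skew : ∀ i j : I, IsAdjoint (B i j) (-(B j i))
  lie : ∀ H F : JetRing I K,
    hamField B (hamField B H F) = ⁅hamField B H, hamField B F⁆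

end Jets

/-- The indices of the variables `A_0, A_1, A_2, …` and of the additional variable `φ`. -/
inductive Idx : Type
  | A (n : ℕ) : Idx
  | phi : Idx

section Matrices

variable {K : Type*} [CommRing K] [Differential K]

/-- Multiplication by the variable `A_n`. -/
def opA (n : ℕ) : DiffOp Idx K := mulOp (MvPolynomial.X (Idx.A n, 0))

/-- Multiplication by an element of `K`. -/
def opC (α : K) : DiffOp Idx K := mulOp (MvPolynomial.C α)

/-- The KP matrix
`B_{nm} = ∑_μ [binom(n, μ) A_{n+m-μ} ∂^μ - (-∂)^μ binom(m, μ) A_{n+m-μ}]`. The binomial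
coefficients vanish outside the ranges of summation. -/
def kpMatrix (n m : ℕ) : DiffOp Idx K :=
  ∑ μ ∈ Finset.range (n + 1), (n.choose μ : DiffOp Idx K) * opA (n + m - μ) * dOp Idx K ^ μ -
    ∑ μ ∈ Finset.range (m + 1), (-dOp Idx K) ^ μ * (m.choose μ : DiffOp Idx K) * opA (n + m - μ)

/-- The Benney matrix `B_{nm} = n A_{n+m-1} ∂ + ∂ m A_{n+m-1}` (which is `0` for `n = m = 0`). -/
def benneyMatrix (n m : ℕ) : DiffOp Idx K :=
  (n : DiffOp Idx K) * opA (n + m - 1) * dOp Idx K + dOp Idx K * (m : DiffOp Idx K) * opA (n + m - 1)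

/-- The extended KP matrix, with
`B_{φm} = α ∑_s (-∂)^s binom(m, s+1) A_{m-1-s}`, `B_{nφ} = -α ∑_s binom(n, s+1) A_{n-1-s} ∂^s`,
`B_{φφ} = 0`. -/
def kpExt (α : K) : Idx → Idx → DiffOp Idx K
  | .A n, .A m => kpMatrix n m
  | .phi, .A m => opC α *
      ∑ s ∈ Finset.range m, (-dOp Idx K) ^ s * (m.choose (s + 1) : DiffOp Idx K) * opA (m - 1 - s)
  | .A n, .phi => -(opC α *
      ∑ s ∈ Finset.range n, (n.choose (s + 1) : DiffOp Idx K) * opA (n - 1 - s) * dOp Idx K ^ s)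
  | .phi, .phi => 0

/-- The extended Benney matrix, with `B_{φm} = α m A_{m-1}`, `B_{nφ} = -α n A_{n-1}`,
`B_{φφ} = 0`. -/
def benneyExt (α : K) : Idx → Idx → DiffOp Idx K
  | .A n, .A m => benneyMatrix n m
  | .phi, .A m => opC α * (m : DiffOp Idx K) * opA (m - 1)
  | .A n, .phi => -(opC α * (n : DiffOp Idx K) * opA (n - 1))
  | .phi, .phi => 0

end Matrices

end DarkEq

end

open scoped Differential

noncomputable section

set_option linter.unusedSectionVars false

namespace DarkEq

/-! ### Evolution fields, gradients and integration by parts. -/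

section Calculus

variable {I K : Type*} [CommRing K] [Differential K]

/-! Both matrices depend linearly on the variables `q_k`. Write `∼` for equality modulo divergences.
Integration by parts turns `B_{ij}(x) z` into a pairing `∑ q_k br(z, x)_k`, with a biadditive
bracket `br` on finitely supported families whose coefficients do not involve the `q_k`.
Differentiating `B` along a field `V` merely replaces `q` by `V` in this pairing. Hence
skew-adjointness follows from antisymmetry of `br`, and the obstruction to `X_{{H,F}} = [X_H, X_F]`,
tested against arbitrary `z`, is the Jacobi expression of `br` paired with `q`; the second variation
of `H` drops out by symmetry, and that of `F` cancels. This is `isHamiltonian_of_lieBracket`.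

It remains to recognize the Lie algebras. For KP, the `A`-components form the differential operator
`∑ X_n ∂^n`, and the bracket is the commutator; for Benney they form the symbol `∑ X_n p^n`, and the
bracket is `f_p g_x - g_p f_x`. The variable `φ` enters as a shift: a family with `φ`-component `u`
acts as its operator, or symbol, minus `α ∂⁻¹u`. Only derivatives of `∂⁻¹u` survive in the bracket,
and they give exactly the `φ` row and column. As `∂⁻¹u` need not exist in the jet ring, the identity
is checked in a larger differential ring (`exists_antiderivatives`) and pulled back by injectivity
(`jacobi_of_realization`, `symbolOp_kpStar`, `symbol_benneyStar`). -/

theorem coeffDeriv_C {σ : Type*} (c : K) :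
    coeffDeriv σ K (MvPolynomial.C c) = MvPolynomial.C c′ := by
  classical
  ext m
  change MvPolynomial.coeff m (coeffFun _) = _
  rw [coeff_coeffFun, MvPolynomial.coeff_C, MvPolynomial.coeff_C]
  split_ifs <;> simp

theorem coeffDeriv_X {σ : Type*} (i : σ) :
    coeffDeriv σ K (MvPolynomial.X i) = 0 := by
  classical
  ext m
  change MvPolynomial.coeff m (coeffFun _) = _
  rw [coeff_coeffFun, MvPolynomial.coeff_X, MvPolynomial.coeff_zero]
  split_ifs <;> simp

/-- The class of a differential polynomial modulo divergences. -/
def functional (I K : Type*) [CommRing K] [Differential K] :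
    JetRing I K →+ JetRing I K ⧸ (totalDeriv I K).toLinearMap.toAddMonoidHom.range :=
  QuotientAddGroup.mk' _

theorem functional_eq_zero_iff (f : JetRing I K) : functional I K f = 0 ↔ IsDivergence f := by
  simp [functional, IsDivergence]

theorem functional_totalDeriv (f : JetRing I K) : functional I K (totalDeriv I K f) = 0 :=
  (functional_eq_zero_iff _).2 ⟨f, rfl⟩

/-- Integration by parts, one `∂` at a time. -/
theorem functional_mul_pow (n : ℕ) (f g : JetRing I K) :
    functional I K (f * (dOp I K ^ n).act g) = functional I K (((-dOp I K) ^ n).act f * g) := by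
  induction n generalizing f with
  | zero => simp
  | succ n ih =>
    rw [pow_succ' (dOp I K), pow_succ (-dOp I K), map_mul DiffOp.act, map_mul DiffOp.act,
      Module.End.mul_apply, Module.End.mul_apply, ← ih, dOp_apply, ← sub_eq_zero, ← map_sub]
    have := functional_totalDeriv (f * (dOp I K ^ n).act g)
    rw [Derivation.leibniz, smul_eq_mul, smul_eq_mul] at this
    rw [← this]
    congr 1
    rw [map_neg, LinearMap.neg_apply, dOp_apply]
    ring

theorem functional_mul_neg_pow (n : ℕ) (f g : JetRing I K) :
    functional I K (f * ((-dOp I K) ^ n).act g) = functional I K ((dOp I K ^ n).act f * g) := by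
  rw [mul_comm, ← functional_mul_pow, mul_comm]

theorem dOp_pow_succ_apply (n : ℕ) (f : JetRing I K) :
    (dOp I K ^ (n + 1)).act f = totalDeriv I K ((dOp I K ^ n).act f) := by
  rw [pow_succ', map_mul, Module.End.mul_apply, dOp_apply]

theorem dOp_pow_X (n : ℕ) (i : I) :
    (dOp I K ^ n).act (MvPolynomial.X (i, 0)) = MvPolynomial.X (i, n) := by
  induction n with
  | zero => simp
  | succ n ih => rw [dOp_pow_succ_apply, ih, totalDeriv_X]

theorem evolField_X (V : I → JetRing I K) (i : I) (n : ℕ) :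
    evolField V (MvPolynomial.X (i, n)) = (dOp I K ^ n).act (V i) := by
  simp [evolField, MvPolynomial.mkDerivation_X]

theorem evolField_C (V : I → JetRing I K) (c : K) :
    evolField V (MvPolynomial.C c) = 0 :=
  (evolField V).map_algebraMap c

theorem evolField_totalDeriv (V : I → JetRing I K) (f : JetRing I K) :
    evolField V (totalDeriv I K f) = totalDeriv I K (evolField V f) := by
  induction f using MvPolynomial.induction_on with
  | C a => rw [totalDeriv_C, evolField_C, evolField_C, map_zero]
  | add p q hp hq => simp only [map_add, hp, hq]
  | mul_X p i hp =>
    obtain ⟨i, n⟩ := i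
    simp only [Derivation.leibniz, map_add, smul_eq_mul, hp, totalDeriv_X, evolField_X,
      dOp_pow_succ_apply]
    ring

theorem evolField_dOp_pow (V : I → JetRing I K) (n : ℕ) (f : JetRing I K) :
    evolField V ((dOp I K ^ n).act f) = (dOp I K ^ n).act (evolField V f) := by
  induction n with
  | zero => simp
  | succ n ih => rw [dOp_pow_succ_apply, dOp_pow_succ_apply, evolField_totalDeriv, ih]

theorem neg_dOp_pow_act (n : ℕ) (f : JetRing I K) :
    ((-dOp I K) ^ n).act f = (-1) ^ n * (dOp I K ^ n).act f := by
  rcases Nat.even_or_odd n with h | h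
  · rw [h.neg_pow, h.neg_pow, one_pow, one_mul]
  · rw [h.neg_pow, h.neg_pow, one_pow, map_neg, LinearMap.neg_apply, neg_one_mul]

theorem evolField_neg_dOp_pow (V : I → JetRing I K) (n : ℕ) (f : JetRing I K) :
    evolField V (((-dOp I K) ^ n).act f) = ((-dOp I K) ^ n).act (evolField V f) := by
  have h : evolField V ((-1) ^ n) = 0 := by
    simp
  rw [neg_dOp_pow_act, neg_dOp_pow_act, Derivation.leibniz, h, evolField_dOp_pow]
  simp

/-- Both sides commute with `∂`, so they agree on all jets as soon as they agree on the `q_i`. -/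
theorem evolField_lie (V W : I → JetRing I K) :
    ⁅evolField V, evolField W⁆ =
      evolField fun i => evolField V (W i) - evolField W (V i) := by
  refine MvPolynomial.derivation_ext fun ⟨i, n⟩ => ?_
  rw [Derivation.commutator_apply]
  simp only [evolField_X, evolField_dOp_pow, map_sub]

/-- The variational derivatives of `H`, as a finitely supported family. -/
def gradient (H : JetRing I K) : I →₀ JetRing I K :=
  Finsupp.ofSupportFinite (varDeriv H) (varDeriv_finite H)

theorem gradient_apply (H : JetRing I K) (i : I) : gradient H i = varDeriv H i := rfl

theorem varDeriv_eq_sum (H : JetRing I K) (i : I) (N : ℕ)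
    (hN : ∀ n, N ≤ n → MvPolynomial.pderiv (i, n) H = 0) :
    varDeriv H i =
      ∑ n ∈ Finset.range N, ((-dOp I K) ^ n).act (MvPolynomial.pderiv (i, n) H) := by
  refine finsum_eq_sum_of_support_subset _ fun n hn => ?_
  by_contra h
  refine hn ?_
  simp only [hN n (by simpa using h), map_zero]

/-! ### The variational derivative kills divergences; nondegeneracy of the pairing. -/

theorem pderiv_totalDeriv_zero (i : I) (f : JetRing I K) :
    MvPolynomial.pderiv (i, 0) (totalDeriv I K f) =
      totalDeriv I K (MvPolynomial.pderiv (i, 0) f) := by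
  classical
  induction f using MvPolynomial.induction_on with
  | C a => simp [totalDeriv_C]
  | add p q hp hq => simp only [map_add, hp, hq]
  | mul_X p j hp =>
    obtain ⟨j, m⟩ := j
    simp only [Derivation.leibniz, map_add, smul_eq_mul, hp, totalDeriv_X,
      MvPolynomial.pderiv_X, Pi.single_apply, Prod.mk.injEq]
    split_ifs <;> simp_all <;> ring

theorem pderiv_totalDeriv_succ (i : I) (n : ℕ) (f : JetRing I K) :
    MvPolynomial.pderiv (i, n + 1) (totalDeriv I K f) =
      totalDeriv I K (MvPolynomial.pderiv (i, n + 1) f) + MvPolynomial.pderiv (i, n) f := by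
  classical
  induction f using MvPolynomial.induction_on with
  | C a => simp [totalDeriv_C]
  | add p q hp hq => simp only [map_add, hp, hq]; ring
  | mul_X p j hp =>
    obtain ⟨j, m⟩ := j
    have h1 (c : Prop) [Decidable c] : totalDeriv I K (if c then 1 else 0) = 0 := by
      split_ifs <;> simp
    simp only [Derivation.leibniz, map_add, smul_eq_mul, hp, totalDeriv_X,
      MvPolynomial.pderiv_X, Pi.single_apply, Prod.mk.injEq, Nat.add_right_cancel_iff, h1]
    ring

theorem exists_pderiv_bound (H : JetRing I K) :
    ∃ N, ∀ i n, N ≤ n → MvPolynomial.pderiv (i, n) H = 0 := by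
  classical
  obtain ⟨N, hN⟩ := (H.vars.image Prod.snd).bddAbove
  refine ⟨N + 1, fun i n hn => MvPolynomial.pderiv_eq_zero_of_notMem_vars fun h => ?_⟩
  have := hN (Finset.mem_coe.2 (Finset.mem_image.2 ⟨_, h, rfl⟩))
  simp only at this
  omega

theorem varDeriv_totalDeriv (f : JetRing I K) (i : I) : varDeriv (totalDeriv I K f) i = 0 := by
  obtain ⟨N, hN⟩ := exists_pderiv_bound f
  -- The commutator of `∂/∂q^{(n+1)}` with `∂` is `∂/∂q^{(n)}`, so the sum telescopes; the boundary
  -- term vanishes beyond the order of `f`.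
  have key : ∀ M, ∑ n ∈ Finset.range (M + 1), ((-dOp I K) ^ n).act
      (MvPolynomial.pderiv (i, n) (totalDeriv I K f)) =
      -((-dOp I K) ^ (M + 1)).act (MvPolynomial.pderiv (i, M) f) := by
    intro M
    induction M with
    | zero => simp [pderiv_totalDeriv_zero, dOp_apply]
    | succ M ih =>
      rw [Finset.sum_range_succ, ih, pderiv_totalDeriv_succ, map_add,
        pow_succ _ (M + 1), map_mul, Module.End.mul_apply, map_neg DiffOp.act,
        LinearMap.neg_apply, dOp_apply, map_neg]
      ring
  rw [varDeriv_eq_sum _ i (N + 1), key, hN i N le_rfl]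
  · simp
  · intro n hn
    obtain ⟨m, rfl⟩ : ∃ m, n = m + 1 := ⟨n - 1, by omega⟩
    rw [pderiv_totalDeriv_succ, hN i _ (by omega), hN i _ (by omega)]
    simp

/-- Test with `g = q_i` for a variable `q_i` that does not occur in `f`: then `δ(f q_i)/δq_i = f`,
while a divergence has variational derivative zero. Infinitely many variables guarantee such an `i`.
-/
theorem eq_zero_of_functional_mul [Infinite I] (f : JetRing I K)
    (hf : ∀ g, functional I K (f * g) = 0) : f = 0 := by
  classical
  obtain ⟨i, hi⟩ := Infinite.exists_notMem_finset (f.vars.image Prod.fst)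
  have h0 : ∀ n, MvPolynomial.pderiv (i, n) f = 0 := fun n =>
    MvPolynomial.pderiv_eq_zero_of_notMem_vars fun h =>
      hi (Finset.mem_image.2 ⟨_, h, rfl⟩)
  obtain ⟨g, hg⟩ := (functional_eq_zero_iff _).1 (hf (MvPolynomial.X (i, 0)))
  have h := varDeriv_totalDeriv g i
  rw [hg, varDeriv_eq_sum _ i 1] at h
  · simpa [Derivation.leibniz, h0] using h
  · intro n hn
    have : ((i, 0) : I × ℕ) ≠ (i, n) := by simp; omega
    simp [Derivation.leibniz, h0, MvPolynomial.pderiv_X_of_ne this]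

/-- The pairing of a family with a finitely supported family. -/
def pairing (V : I → JetRing I K) : (I →₀ JetRing I K) →+ JetRing I K :=
  Finsupp.liftAddHom fun i => AddMonoidHom.mulLeft (V i)

theorem pairing_single (V : I → JetRing I K) (i : I) (z : JetRing I K) :
    pairing V (Finsupp.single i z) = V i * z := by
  simp [pairing]

theorem pairing_apply (V : I → JetRing I K) (Z : I →₀ JetRing I K) :
    pairing V Z = Z.sum fun i z => V i * z := by
  simp [pairing, Finsupp.liftAddHom_apply]

theorem pairing_sub (V W : I → JetRing I K) (Z : I →₀ JetRing I K) :
    pairing (fun i => V i - W i) Z = pairing V Z - pairing W Z := by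
  simp [pairing_apply, sub_mul, Finsupp.sum]

theorem derivation_sum_apply {σ ι : Type*} (s : Finset ι)
    (D : ι → Derivation K (MvPolynomial σ K) (MvPolynomial σ K)) (f : MvPolynomial σ K) :
    (∑ i ∈ s, D i) f = ∑ i ∈ s, D i f := by
  classical
  induction s using Finset.induction_on with
  | empty => simp
  | insert a s ha ih => rw [Finset.sum_insert ha, Finset.sum_insert ha, Derivation.add_apply, ih]

/-- First variation formula: the chain rule gives `V(H) = ∑ ∂H/∂q_i^{(n)} ∂^n(V_i)`, and integrating
by parts collects the variational derivatives. -/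
theorem functional_evolField (V : I → JetRing I K) (H : JetRing I K) :
    functional I K (evolField V H) = functional I K (pairing V (gradient H)) := by
  classical
  obtain ⟨N, hN⟩ := exists_pderiv_bound H
  have hs : ∀ i ∉ H.vars.image Prod.fst, ∀ n, MvPolynomial.pderiv (i, n) H = 0 :=
    fun i hi n => MvPolynomial.pderiv_eq_zero_of_notMem_vars fun h =>
      hi (Finset.mem_image.2 ⟨_, h, rfl⟩)
  obtain ⟨M, hM⟩ := (H.vars.image Prod.snd).bddAbove
  set s := H.vars.image Prod.fst with hsdef
  have h1 : evolField V H = ∑ i ∈ s, ∑ n ∈ Finset.range (max N (M + 1)),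
      MvPolynomial.pderiv (i, n) H * (dOp I K ^ n).act (V i) := by
    -- Two derivations over `K` that agree on the variables occurring in `H` agree at `H`; the range
    -- bound `M + 1` covers all these jets.
    have : evolField V H = (∑ p ∈ s ×ˢ Finset.range (max N (M + 1)),
        (dOp I K ^ p.2).act (V p.1) • MvPolynomial.pderiv (R := K) p) H := by
      refine MvPolynomial.derivation_eq_of_forall_mem_vars fun ⟨i, n⟩ hi => ?_
      rw [evolField_X, derivation_sum_apply, Finset.sum_eq_single (i, n)]
      · simp
      · intro p _ hp
        simp [MvPolynomial.pderiv_X_of_ne (Ne.symm hp)]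
      · intro h
        refine absurd (Finset.mem_product.2 ⟨Finset.mem_image.2 ⟨_, hi, rfl⟩, ?_⟩) h
        have := hM (Finset.mem_coe.2 (Finset.mem_image.2 ⟨_, hi, rfl⟩))
        simp only [Finset.mem_range] at this ⊢
        omega
    rw [this, derivation_sum_apply, Finset.sum_product]
    simp [mul_comm]
  have h2 : pairing V (gradient H) = ∑ i ∈ s, ∑ n ∈ Finset.range (max N (M + 1)),
      ((-dOp I K) ^ n).act (MvPolynomial.pderiv (i, n) H) * V i := by
    rw [pairing_apply, Finsupp.sum_of_support_subset (s := s)]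
    · refine Finset.sum_congr rfl fun i _ => ?_
      rw [gradient_apply, varDeriv_eq_sum _ i (max N (M + 1))
        (fun n hn => hN i n (le_trans (le_max_left _ _) hn)), mul_comm, Finset.sum_mul]
    · intro i hi
      by_contra h
      refine Finsupp.mem_support_iff.1 hi ?_
      rw [gradient_apply, varDeriv_eq_sum _ i 0 (fun n _ => hs i h n), Finset.sum_range_zero]
    · simp
  simp only [h1, h2, map_sum, functional_mul_pow]

/-- The coefficientwise action of an evolution field. -/
def evolMap (V : I → JetRing I K) : (I →₀ JetRing I K) →+ (I →₀ JetRing I K) :=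
  Finsupp.mapRange.addMonoidHom (evolField V).toLinearMap.toAddMonoidHom

theorem evolMap_single (V : I → JetRing I K) (i : I) (z : JetRing I K) :
    evolMap V (Finsupp.single i z) = Finsupp.single i (evolField V z) := by
  simp [evolMap]

theorem evolField_pairing (V W : I → JetRing I K) (Z : I →₀ JetRing I K) :
    evolField V (pairing W Z) =
      pairing (fun i => evolField V (W i)) Z + pairing W (evolMap V Z) := by
  induction Z using Finsupp.induction_linear with
  | zero => simp
  | add X Y hX hY => simp only [map_add, hX, hY]; ring
  | single i z => simp only [pairing_single, evolMap_single, Derivation.leibniz, smul_eq_mul]; ring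

theorem functional_evolField_congr (V : I → JetRing I K) {f g : JetRing I K}
    (h : functional I K f = functional I K g) :
    functional I K (evolField V f) = functional I K (evolField V g) := by
  rw [← sub_eq_zero, ← map_sub, functional_eq_zero_iff] at h ⊢
  obtain ⟨u, hu⟩ := h
  exact ⟨evolField V u, by rw [← evolField_totalDeriv, hu, map_sub]⟩

/-- The linearization of a gradient is self-adjoint. -/
theorem functional_pairing_evolMap_gradient (V W : I → JetRing I K) (H : JetRing I K) :
    functional I K (pairing W (evolMap V (gradient H))) =
      functional I K (pairing V (evolMap W (gradient H))) := by
  -- Expand `V(W(H)) - W(V(H))` by differentiating the first variation formula, and compare with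
  -- that formula for `[V, W]`; what remains is the symmetry of the second variation.
  have h1 := functional_evolField_congr V (functional_evolField W H)
  have h2 := functional_evolField_congr W (functional_evolField V H)
  have h3 := functional_evolField (fun i => evolField V (W i) - evolField W (V i)) H
  rw [← evolField_lie, Derivation.commutator_apply, pairing_sub] at h3
  rw [evolField_pairing] at h1 h2
  simp only [map_sub, map_add] at h1 h2 h3
  rw [h1, h2] at h3
  rw [← sub_eq_zero]
  rw [← sub_eq_zero] at h3
  rw [← h3]
  abel

/-- The action of a matrix of differential operators on a finitely supported family. -/
def matAct (B : I → I → DiffOp I K) (i : I) : (I →₀ JetRing I K) →+ JetRing I K :=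
  Finsupp.liftAddHom fun j => (B i j).act.toAddMonoidHom

theorem matAct_single (B : I → I → DiffOp I K) (i j : I) (x : JetRing I K) :
    matAct B i (Finsupp.single j x) = (B i j).act x := by
  simp [matAct]

theorem hamField_eq (B : I → I → DiffOp I K) (H : JetRing I K) :
    hamField B H = evolField fun i => matAct B i (gradient H) := by
  unfold hamField
  congr 1
  funext i
  rw [matAct, Finsupp.liftAddHom_apply, Finsupp.sum]
  refine finsum_eq_sum_of_support_subset _ fun j hj => ?_
  by_contra h
  refine hj ?_
  have h0 : varDeriv H j = 0 := by
    simpa [← gradient_apply] using h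
  simp only [h0, map_zero]

/-- The extension of a family of biadditive maps to finitely supported families. -/
def bilift {M : Type*} [AddCommGroup M] (b : I → I → M →+ M →+ (I →₀ M)) :
    (I →₀ M) →+ (I →₀ M) →+ (I →₀ M) :=
  Finsupp.liftAddHom fun i => (Finsupp.liftAddHom fun j => (b i j).flip).flip

theorem bilift_single {M : Type*} [AddCommGroup M] (b : I → I → M →+ M →+ (I →₀ M))
    (i j : I) (z x : M) : bilift b (Finsupp.single i z) (Finsupp.single j x) = b i j z x := by
  simp [bilift]

theorem functional_pairing_matAct {B : I → I → DiffOp I K}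
    {br : (I →₀ JetRing I K) →+ (I →₀ JetRing I K) →+ (I →₀ JetRing I K)}
    {q : I → JetRing I K}
    (h : ∀ i j z x, functional I K ((B i j).act x * z) =
      functional I K (pairing q (br (Finsupp.single i z) (Finsupp.single j x))))
    (Z X : I →₀ JetRing I K) :
    functional I K (pairing (fun i => matAct B i X) Z) = functional I K (pairing q (br Z X)) := by
  induction Z using Finsupp.induction_linear with
  | zero => simp
  | add Z₁ Z₂ h₁ h₂ => simp only [map_add, h₁, h₂, AddMonoidHom.add_apply]
  | single i z =>
    rw [pairing_single]
    induction X using Finsupp.induction_linear with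
    | zero => simp
    | add X₁ X₂ h₁ h₂ => simp only [map_add, add_mul, h₁, h₂]
    | single j x => rw [matAct_single, h]

/-- Product rule for `V(B X)`: the hypothesis says that differentiating the coefficients of `B` puts
`V` in place of `q` in the pairing with `br`. -/
theorem functional_pairing_evolField_matAct {B : I → I → DiffOp I K}
    {br : (I →₀ JetRing I K) →+ (I →₀ JetRing I K) →+ (I →₀ JetRing I K)}
    (V : I → JetRing I K)
    (h : ∀ i j z x, functional I K
        ((evolField V ((B i j).act x) - (B i j).act (evolField V x)) * z) =
      functional I K (pairing V (br (Finsupp.single i z) (Finsupp.single j x))))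
    (Z X : I →₀ JetRing I K) :
    functional I K (pairing (fun i => evolField V (matAct B i X)) Z) =
      functional I K (pairing (fun i => matAct B i (evolMap V X)) Z) +
        functional I K (pairing V (br Z X)) := by
  rw [← sub_eq_iff_eq_add', ← map_sub, ← pairing_sub]
  induction Z using Finsupp.induction_linear with
  | zero => simp
  | add Z₁ Z₂ h₁ h₂ => simp only [map_add, h₁, h₂, AddMonoidHom.add_apply]
  | single i z =>
    rw [pairing_single]
    induction X using Finsupp.induction_linear with
    | zero => simp
    | add X₁ X₂ h₁ h₂ =>
      rw [map_add (br _), map_add (pairing V), map_add (functional I K), ← h₁, ← h₂,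
        ← map_add (functional I K), map_add (matAct B i), map_add (evolMap V),
        map_add (matAct B i), map_add (evolField V)]
      congr 1
      ring
    | single j x => rw [matAct_single, evolMap_single, matAct_single, h]

/-- A matrix that depends linearly on the variables is Hamiltonian when the bilinear operation it
defines is a Lie bracket. -/
theorem isHamiltonian_of_lieBracket [Infinite I] (B : I → I → DiffOp I K)
    (br : (I →₀ JetRing I K) →+ (I →₀ JetRing I K) →+ (I →₀ JetRing I K))
    (hq : ∀ i j z x, functional I K ((B i j).act x * z) = functional I K
      (pairing (fun k => MvPolynomial.X (k, 0)) (br (Finsupp.single i z) (Finsupp.single j x))))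
    (hV : ∀ V i j z x, functional I K
        ((evolField V ((B i j).act x) - (B i j).act (evolField V x)) * z) =
      functional I K (pairing V (br (Finsupp.single i z) (Finsupp.single j x))))
    (anti : ∀ X Y, br X Y = -br Y X)
    (jacobi : ∀ X Y Z, br (br Y Z) X - br (br Y X) Z + br (br Z X) Y = 0) :
    IsHamiltonian B := by
  have skew : ∀ Z X : I →₀ JetRing I K, functional I K (pairing (fun i => matAct B i X) Z) =
      -functional I K (pairing (fun i => matAct B i Z) X) := fun Z X => by
    rw [functional_pairing_matAct hq, functional_pairing_matAct hq, anti, map_neg, map_neg]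
  refine ⟨fun i j f g => ?_, fun H F => ?_⟩
  · have := skew (Finsupp.single i f) (Finsupp.single j g)
    rw [pairing_single, pairing_single, matAct_single, matAct_single] at this
    rw [← functional_eq_zero_iff, map_neg, LinearMap.neg_apply, neg_mul, sub_neg_eq_add, map_add,
      mul_comm, this, neg_add_cancel]
  · simp only [hamField_eq]
    rw [evolField_lie]
    congr 1
    funext i
    rw [← sub_eq_zero]
    -- Each component is tested against an arbitrary `z`. Below, `X`, `Y` are the gradients of `H`,
    -- `F`, the family `Z` is `z` in position `i`, and `U`, `W`, `T` are the images of `X`, `Y`, `Z`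
    -- under `B`.
    refine eq_zero_of_functional_mul _ fun z => ?_
    generalize hX : gradient H = X
    generalize hY : gradient F = Y
    generalize hZ : Finsupp.single i z = Z
    generalize hU : (fun i => matAct B i X) = U
    generalize hW : (fun i => matAct B i Y) = W
    generalize hT : (fun i => matAct B i Z) = T
    generalize hG : gradient (evolField U F) = G
    have g : functional I K ((matAct B i G -
          (evolField U (matAct B i Y) - evolField W (matAct B i X))) * z) =
        functional I K (pairing (fun i => matAct B i G) Z) -
          functional I K (pairing (fun i => evolField U (matAct B i Y)) Z) +
          functional I K (pairing (fun i => evolField W (matAct B i X)) Z) := by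
      rw [← hZ, pairing_single, pairing_single, pairing_single, ← map_sub, ← map_add]
      congr 1
      ring
    have e0 : functional I K (pairing (fun i => matAct B i G) Z) =
        -functional I K (evolField T (evolField U F)) := by
      rw [skew Z G, hT, ← hG, functional_evolField T (evolField U F)]
    -- Writing `T U F = [T, U] F + U T F` leaves only the gradient of `F` in the commutator term.
    have e1 : functional I K (evolField T (evolField U F)) =
        functional I K (pairing (fun i => evolField T (matAct B i X)) Y) -
          functional I K (pairing (fun i => evolField U (matAct B i Z)) Y) +
          functional I K (evolField U (evolField T F)) := by
      have := functional_evolField (fun i => evolField T (U i) - evolField U (T i)) F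
      rw [← evolField_lie, Derivation.commutator_apply, pairing_sub, map_sub, map_sub,
        sub_eq_iff_eq_add, hY] at this
      subst hU hT
      exact this
    -- Since `T F ∼ T·Y ∼ -W·Z`, applying `U` gives a term that cancels `U(B Y)·Z` in `g`; no second
    -- variation of `F` remains.
    have e2 : functional I K (evolField U (evolField T F)) =
        -(functional I K (pairing (fun i => evolField U (matAct B i Y)) Z) +
          functional I K (pairing W (evolMap U Z))) := by
      rw [← map_add, ← hW, ← evolField_pairing, ← map_neg, ← map_neg]
      refine functional_evolField_congr U ?_
      rw [functional_evolField, hY, map_neg, ← hT]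
      exact skew Y Z
    have a1 := functional_pairing_evolField_matAct T (hV T) Y X
    have a2 := functional_pairing_evolField_matAct U (hV U) Y Z
    have a3 := functional_pairing_evolField_matAct W (hV W) Z X
    have s1 := skew Y (evolMap T X)
    have s2 := skew Y (evolMap U Z)
    have s3 := skew Z (evolMap W X)
    -- After `s1` and `s3`, the derivatives of `X` appear as `W·T(X) - T·W(X)`, which vanishes
    -- modulo divergences because `X` is a gradient.
    have hh := functional_pairing_evolMap_gradient T W H
    -- The contributions of differentiating `B` assemble into the Jacobi expression, since `U`, `W`,
    -- `T` are themselves images under `B`.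
    have j1 : functional I K (pairing U (br Y Z)) - functional I K (pairing T (br Y X)) +
        functional I K (pairing W (br Z X)) = 0 := by
      rw [← hU, ← hW, ← hT, functional_pairing_matAct hq, functional_pairing_matAct hq,
        functional_pairing_matAct hq, ← map_sub, ← map_sub, ← map_add, ← map_add, jacobi,
        map_zero, map_zero]
    rw [hX] at hh
    rw [hW] at s1 s2
    rw [hT] at s3
    rw [g, e0, e1, e2, a1, a2, a3, s1, s2, s3, hh, ← j1]
    abel

end Calculus

/-! ### From matrices linear in the variables to bilinear brackets. -/

section Forms

variable {K : Type*} [CommRing K] [Differential K]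

/-- The biadditive map `(z, x) ↦ c z ∂^μ(x) e_k`. -/
def jetTerm (c : K) (k μ : ℕ) :
    JetRing Idx K →+ JetRing Idx K →+ (Idx →₀ JetRing Idx K) :=
  AddMonoidHom.mk' (fun z => ((Finsupp.singleAddHom (Idx.A k)).comp
    (AddMonoidHom.mulLeft (MvPolynomial.C c * z))).comp (dOp Idx K ^ μ).act.toAddMonoidHom)
    (fun z w => AddMonoidHom.ext fun x => by simp [mul_add, add_mul])

theorem jetTerm_apply (c : K) (k μ : ℕ) (z x : JetRing Idx K) :
    jetTerm c k μ z x =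
      Finsupp.single (Idx.A k) (MvPolynomial.C c * z * (dOp Idx K ^ μ).act x) := rfl

/-- The operator `P`, linear in the variables, corresponds to the bilinear operation `t`:
modulo divergences, `P(x) z` is the pairing of the variables with `t z x`. -/
structure Represents (P : DiffOp Idx K)
    (t : JetRing Idx K → JetRing Idx K → (Idx →₀ JetRing Idx K)) : Prop where
  act : ∀ z x, functional Idx K (P.act x * z) =
    functional Idx K (pairing (fun k => MvPolynomial.X (k, 0)) (t z x))
  evol : ∀ V z x, functional Idx K ((evolField V (P.act x) - P.act (evolField V x)) * z) =
    functional Idx K (pairing V (t z x))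

theorem Represents.zero : Represents (0 : DiffOp Idx K) (fun _ _ => 0) :=
  ⟨fun z x => by simp, fun V z x => by simp⟩

theorem Represents.add {P Q : DiffOp Idx K}
    {s t : JetRing Idx K → JetRing Idx K → (Idx →₀ JetRing Idx K)}
    (hP : Represents P s) (hQ : Represents Q t) :
    Represents (P + Q) (fun z x => s z x + t z x) := by
  refine ⟨fun z x => ?_, fun V z x => ?_⟩
  · simp only [map_add, LinearMap.add_apply, add_mul, hP.act, hQ.act]
  · simp only [map_add DiffOp.act, map_add (pairing V), map_add (functional Idx K),
      LinearMap.add_apply, ← hP.evol, ← hQ.evol, map_add (evolField V)]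
    rw [← map_add (functional Idx K)]
    congr 1
    ring

theorem Represents.neg {P : DiffOp Idx K}
    {s : JetRing Idx K → JetRing Idx K → (Idx →₀ JetRing Idx K)}
    (hP : Represents P s) : Represents (-P) (fun z x => -s z x) := by
  refine ⟨fun z x => ?_, fun V z x => ?_⟩
  · simp only [map_neg, LinearMap.neg_apply, neg_mul, hP.act]
  · simp only [map_neg DiffOp.act, map_neg (pairing V), map_neg (functional Idx K),
      LinearMap.neg_apply, ← hP.evol, map_neg (evolField V)]
    rw [← map_neg (functional Idx K)]
    congr 1
    ring

theorem Represents.sub {P Q : DiffOp Idx K}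
    {s t : JetRing Idx K → JetRing Idx K → (Idx →₀ JetRing Idx K)}
    (hP : Represents P s) (hQ : Represents Q t) :
    Represents (P - Q) (fun z x => s z x - t z x) := by
  simp only [sub_eq_add_neg]
  exact hP.add hQ.neg

theorem Represents.sum {ι : Type*} (s : Finset ι) {P : ι → DiffOp Idx K}
    {t : ι → JetRing Idx K → JetRing Idx K → (Idx →₀ JetRing Idx K)}
    (h : ∀ i ∈ s, Represents (P i) (t i)) :
    Represents (∑ i ∈ s, P i) (fun z x => ∑ i ∈ s, t i z x) := by
  classical
  induction s using Finset.induction_on with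
  | empty => exact Represents.zero
  | insert a s ha ih =>
    simp only [Finset.sum_insert ha]
    exact (h a (Finset.mem_insert_self a s)).add
      (ih fun i hi => h i (Finset.mem_insert_of_mem hi))

theorem represents_jetTerm (c : K) (k μ : ℕ) :
    Represents (opC c * opA k * dOp Idx K ^ μ) (fun z x => jetTerm c k μ z x) := by
  have h (x : JetRing Idx K) : (opC c * opA k * dOp Idx K ^ μ).act x =
      MvPolynomial.C c * (MvPolynomial.X (Idx.A k, 0) * (dOp Idx K ^ μ).act x) := by
    rw [map_mul, map_mul]; rfl
  refine ⟨fun z x => ?_, fun V z x => ?_⟩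
  · rw [h, jetTerm_apply, pairing_single]
    congr 1
    ring
  · rw [h, h, jetTerm_apply, pairing_single]
    congr 1
    simp only [Derivation.leibniz, evolField_C, evolField_X, evolField_dOp_pow, pow_zero, map_one,
      Module.End.one_apply, smul_eq_mul]
    ring

/-- This operator is the adjoint of the one in `represents_jetTerm`: moving `(-∂)^μ` onto `z`
exchanges the roles of `z` and `x`. -/
theorem represents_jetTerm_flip (c : K) (k μ : ℕ) :
    Represents ((-dOp Idx K) ^ μ * opC c * opA k) (fun z x => jetTerm c k μ x z) := by
  have h (x : JetRing Idx K) : ((-dOp Idx K) ^ μ * opC c * opA k).act x =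
      ((-dOp Idx K) ^ μ).act (MvPolynomial.C c * (MvPolynomial.X (Idx.A k, 0) * x)) := by
    rw [map_mul, map_mul]; rfl
  refine ⟨fun z x => ?_, fun V z x => ?_⟩
  · rw [h, mul_comm, functional_mul_neg_pow, jetTerm_apply, pairing_single]
    congr 1
    ring
  · rw [h, h, evolField_neg_dOp_pow, ← map_sub, mul_comm, functional_mul_neg_pow,
      jetTerm_apply, pairing_single]
    congr 1
    simp only [Derivation.leibniz, evolField_C, evolField_X, pow_zero, map_one,
      Module.End.one_apply, smul_eq_mul]
    ring

theorem opC_natCast (n : ℕ) : (opC (n : K) : DiffOp Idx K) = n := by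
  induction n with
  | zero =>
    refine Subtype.ext (LinearMap.ext fun f => ?_)
    have h : (((0 : ℕ) : DiffOp Idx K) : DiffOp Idx K).act f = 0 := by simp
    refine Eq.trans ?_ h.symm
    change MvPolynomial.C ((0 : ℕ) : K) * f = 0
    simp
  | succ n ih =>
    rw [Nat.cast_succ (R := DiffOp Idx K), ← ih]
    refine Subtype.ext (LinearMap.ext fun f => ?_)
    change MvPolynomial.C ((n + 1 : ℕ) : K) * f = MvPolynomial.C (n : K) * f + f
    rw [Nat.cast_succ, map_add, map_one]
    ring

theorem opC_mul (a b : K) : opC (a * b) = opC a * opC b := by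
  refine Subtype.ext (LinearMap.ext fun f => ?_)
  change MvPolynomial.C (a * b) * f = MvPolynomial.C a * (MvPolynomial.C b * f)
  rw [map_mul, mul_assoc]

theorem opC_commute_dOp {α : K} (hα : α′ = 0) : Commute (opC α) (dOp Idx K) := by
  refine Subtype.ext (LinearMap.ext fun f => ?_)
  change MvPolynomial.C α * totalDeriv Idx K f = totalDeriv Idx K (MvPolynomial.C α * f)
  rw [Derivation.leibniz, totalDeriv_C, hα]
  simp

/-- The product of two differential operators with components in `A`, and the action of the
component `φ`. -/
def kpStar (α : K) : Idx → Idx → JetRing Idx K →+ JetRing Idx K →+ (Idx →₀ JetRing Idx K)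
  | .A n, .A m => ∑ μ ∈ Finset.range (n + 1), jetTerm (n.choose μ : K) (n + m - μ) μ
  | .A n, .phi => -∑ s ∈ Finset.range n, jetTerm (α * (n.choose (s + 1) : K)) (n - 1 - s) s
  | .phi, _ => 0

/-- The product `f_p g_x` of polynomial symbols, and the action of the component `φ`. -/
def benneyStar (α : K) : Idx → Idx → JetRing Idx K →+ JetRing Idx K →+ (Idx →₀ JetRing Idx K)
  | .A n, .A m => jetTerm (n : K) (n + m - 1) 1
  | .A n, .phi => -jetTerm (α * (n : K)) (n - 1) 0
  | .phi, _ => 0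

theorem represents_kpExt {α : K} (hα : α′ = 0) (i j : Idx) :
    Represents (kpExt α i j) (fun z x => kpStar α i j z x - kpStar α j i x z) := by
  cases i with
  | A n =>
    cases j with
    | A m =>
      simp only [kpExt, kpMatrix, kpStar, AddMonoidHom.finsetSum_apply]
      refine Represents.sub (Represents.sum _ fun μ _ => ?_) (Represents.sum _ fun μ _ => ?_)
      · rw [← opC_natCast]
        exact represents_jetTerm _ _ _
      · rw [← opC_natCast, add_comm n m]
        exact represents_jetTerm_flip _ _ _
    | phi =>
      simp only [kpExt, kpStar, AddMonoidHom.finsetSum_apply, AddMonoidHom.zero_apply, sub_zero,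
        AddMonoidHom.neg_apply, Finset.mul_sum]
      refine (Represents.sum _ fun s _ => ?_).neg
      rw [← opC_natCast, ← mul_assoc, ← mul_assoc, ← opC_mul]
      exact represents_jetTerm _ _ _
  | phi =>
    cases j with
    | A m =>
      simp only [kpExt, kpStar, AddMonoidHom.finsetSum_apply, AddMonoidHom.zero_apply, zero_sub,
        AddMonoidHom.neg_apply, neg_neg, Finset.mul_sum]
      refine Represents.sum _ fun s _ => ?_
      -- The factor `α` stands to the left of `(-∂)^s` and must be moved past it; this is where `α`
      -- has to be constant.
      rw [← opC_natCast, ← mul_assoc, ← mul_assoc,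
        ((opC_commute_dOp hα).neg_right.pow_right s).eq, mul_assoc (_ ^ s), ← opC_mul]
      exact represents_jetTerm_flip _ _ _
    | phi =>
      simp only [kpExt, kpStar, AddMonoidHom.zero_apply, sub_zero]
      exact Represents.zero

theorem represents_benneyExt (α : K) (i j : Idx) :
    Represents (benneyExt α i j) (fun z x => benneyStar α i j z x - benneyStar α j i x z) := by
  cases i with
  | A n =>
    cases j with
    | A m =>
      simp only [benneyExt, benneyMatrix, benneyStar]
      rw [← opC_natCast, ← opC_natCast]
      have h := (represents_jetTerm (n : K) (n + m - 1) 1).sub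
        (represents_jetTerm_flip (m : K) (m + n - 1) 1)
      -- The sign of `(-∂)^1` turns the difference of a term and its flip into the sum in the Benney
      -- matrix.
      rw [pow_one, pow_one, neg_mul, neg_mul, sub_neg_eq_add, add_comm m n] at h
      rwa [add_comm m n]
    | phi =>
      simp only [benneyExt, benneyStar, AddMonoidHom.zero_apply, sub_zero, AddMonoidHom.neg_apply]
      rw [← opC_natCast, ← opC_mul]
      have h := (represents_jetTerm (α * (n : K)) (n - 1) 0).neg
      rwa [pow_zero, mul_one] at h
  | phi =>
    cases j with
    | A m =>
      simp only [benneyExt, benneyStar, AddMonoidHom.zero_apply, zero_sub, AddMonoidHom.neg_apply,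
        neg_neg]
      rw [← opC_natCast, ← opC_mul]
      have h := represents_jetTerm_flip (α * (m : K)) (m - 1) 0
      rwa [pow_zero, one_mul] at h
    | phi =>
      simp only [benneyExt, benneyStar, AddMonoidHom.zero_apply, sub_zero]
      exact Represents.zero

end Forms

/-! ### Jacobi identity by realization; operators and symbols. -/

section Jacobi

/-- Every differential ring embeds into one in which all its elements have antiderivatives. -/
theorem exists_antiderivatives {R : Type*} [CommRing R] (d : Derivation ℤ R R) :
    ∃ (D : Derivation ℤ (MvPolynomial R R) (MvPolynomial R R)) (J : R → MvPolynomial R R),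
      (∀ r, D (MvPolynomial.C r) = MvPolynomial.C (d r)) ∧ J 0 = 0 ∧
        ∀ r, D (J r) = MvPolynomial.C r := by
  classical
  let _ : Differential R := ⟨d⟩
  -- Adjoin one variable for each `r`, with derivative `r`. `J` is not additive; only `J 0 = 0` is
  -- imposed, so that the shift by `J` disappears for families without `φ`-component.
  refine ⟨coeffDeriv R R + (MvPolynomial.mkDerivation R
    (fun r : R => (MvPolynomial.C r : MvPolynomial R R))).restrictScalars ℤ,
    fun r => if r = 0 then 0 else MvPolynomial.X r, fun r => ?_, if_pos rfl, fun r => ?_⟩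
  · simp [coeffDeriv_C]
    rfl
  · dsimp only
    split_ifs with h
    · simp [h]
    · simp [coeffDeriv_X, MvPolynomial.mkDerivation_X]

/-- A bracket is a Lie bracket when it is realized, up to elements that depend on the component
`φ` only, by a bracket that satisfies the Jacobi identity. -/
theorem jacobi_of_realization {R L : Type*} [AddCommGroup R] [AddCommGroup L]
    (br : (Idx →₀ R) →+ (Idx →₀ R) →+ (Idx →₀ R)) (lb : L → L → L)
    (jac : ∀ a b c, lb (lb b c) a - lb (lb b a) c + lb (lb c a) b = 0)
    (Φ : (Idx →₀ R) →+ L) (P : (Idx →₀ R) → L)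
    (hP : ∀ Z, Z Idx.phi = 0 → P Z = Φ Z)
    (hbr : ∀ X Y, br X Y Idx.phi = 0)
    (hlb : ∀ X Y, Φ (br X Y) = lb (P X) (P Y))
    (inj : ∀ Z, Z Idx.phi = 0 → Φ Z = 0 → Z = 0) (X Y Z : Idx →₀ R) :
    br (br Y Z) X - br (br Y X) Z + br (br Z X) Y = 0 := by
  -- Brackets have no `φ`-component, so `P` and `Φ` coincide on them and the nested brackets turn
  -- into nested brackets in `L`. `P` need not be additive.
  refine inj _ (by simp [hbr]) ?_
  rw [map_add, map_sub, hlb (br Y Z), hlb (br Y X), hlb (br Z X), hP _ (hbr _ _), hP _ (hbr _ _),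
    hP _ (hbr _ _), hlb, hlb, hlb, jac]

variable {K : Type*} [CommRing K] [Differential K]

theorem bilift_phi_eq_zero
    (s : Idx → Idx → JetRing Idx K →+ JetRing Idx K →+ (Idx →₀ JetRing Idx K))
    (h : ∀ i j z x, s i j z x Idx.phi = 0) (X Y : Idx →₀ JetRing Idx K) :
    bilift s X Y Idx.phi = 0 := by
  induction X using Finsupp.induction_linear with
  | zero => simp
  | add A B hA hB => simp [hA, hB]
  | single i z =>
    induction Y using Finsupp.induction_linear with
    | zero => simp
    | add A B hA hB => simp [hA, hB]
    | single j x => rw [bilift_single, h]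

theorem jetTerm_phi (c : K) (k μ : ℕ) (z x : JetRing Idx K) :
    jetTerm c k μ z x Idx.phi = 0 := by
  rw [jetTerm_apply, Finsupp.single_eq_of_ne (by simp)]

theorem kpStar_phi (α : K) (i j : Idx) (z x : JetRing Idx K) :
    kpStar α i j z x Idx.phi = 0 := by
  cases i <;> cases j <;>
    simp [kpStar, AddMonoidHom.finsetSum_apply, Finsupp.finsetSum_apply, jetTerm_phi]

theorem benneyStar_phi (α : K) (i j : Idx) (z x : JetRing Idx K) :
    benneyStar α i j z x Idx.phi = 0 := by
  cases i <;> cases j <;> simp [benneyStar, jetTerm_phi]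

section Symbols

variable {S : Type*} [CommRing S] (D : Derivation ℤ S S) (c : JetRing Idx K →+* S)

open Polynomial in
/-- The symbol `∑ X_n p^n`. -/
def symbol : (Idx →₀ JetRing Idx K) →+ S[X] :=
  Finsupp.liftAddHom fun
    | .A n => (monomial n).toAddMonoidHom.comp c.toAddMonoidHom
    | .phi => 0

open Polynomial in
theorem symbol_single_A (n : ℕ) (z : JetRing Idx K) :
    symbol c (Finsupp.single (Idx.A n) z) = monomial n (c z) := by
  simp [symbol]

theorem symbol_single_phi (z : JetRing Idx K) :
    symbol c (Finsupp.single Idx.phi z) = 0 := by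
  simp [symbol]

theorem symbol_coeff (X : Idx →₀ JetRing Idx K) (n : ℕ) :
    (symbol c X).coeff n = c (X (Idx.A n)) := by
  classical
  induction X using Finsupp.induction_linear with
  | zero => simp
  | add X Y hX hY => simp [hX, hY]
  | single i z =>
    cases i with
    | A m => simp [symbol_single_A, Polynomial.coeff_monomial, Finsupp.single_apply, apply_ite c]
    | phi => simp [symbol_single_phi]

theorem eq_zero_of_symbol (hc : Function.Injective c) (Z : Idx →₀ JetRing Idx K)
    (h0 : Z Idx.phi = 0) (h : symbol c Z = 0) : Z = 0 := by
  ext1 i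
  cases i with
  | A n =>
    apply hc
    rw [← symbol_coeff, h]
    simp
  | phi => exact h0

/-- The operator `∑ X_n ∂^n`. -/
def symbolOp : (Idx →₀ JetRing Idx K) →+ Module.End ℤ S :=
  Finsupp.liftAddHom fun
    | .A n => (AddMonoidHom.mulRight (D.toLinearMap ^ n : Module.End ℤ S)).comp
        ((Algebra.lmul ℤ S).toRingHom.toAddMonoidHom.comp c.toAddMonoidHom)
    | .phi => 0

theorem symbolOp_single_A (n : ℕ) (z : JetRing Idx K) :
    symbolOp D c (Finsupp.single (Idx.A n) z) =
      Algebra.lmul ℤ S (c z) * D.toLinearMap ^ n := by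
  simp [symbolOp]

theorem symbolOp_single_phi (z : JetRing Idx K) :
    symbolOp D c (Finsupp.single Idx.phi z) = 0 := by
  simp [symbolOp]

/-- The Leibniz rule. -/
theorem pow_mul_lmul (n : ℕ) (f : S) :
    (D.toLinearMap ^ n : Module.End ℤ S) * Algebra.lmul ℤ S f =
      ∑ μ ∈ Finset.range (n + 1), (n.choose μ : Module.End ℤ S) *
        Algebra.lmul ℤ S ((D.toLinearMap ^ μ : Module.End ℤ S) f) * D.toLinearMap ^ (n - μ) := by
  set a : Module.End ℤ S := D.toLinearMap
  -- Left multiplication by `a` is `ad a` plus right multiplication by `a`; the two commute, so the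
  -- binomial theorem applies, and `ad a` differentiates multiplication operators.
  let ad : Module.End ℤ (Module.End ℤ S) := LinearMap.mulLeft ℤ a - LinearMap.mulRight ℤ a
  have had : ∀ g : S, ad (Algebra.lmul ℤ S g) = Algebra.lmul ℤ S (a g) := fun g => by
    ext h
    simp [ad, a, Derivation.leibniz]
    ring
  have hadp : ∀ μ, (ad ^ μ) (Algebra.lmul ℤ S f) = Algebra.lmul ℤ S ((a ^ μ) f) := by
    intro μ
    induction μ with
    | zero => simp
    | succ μ ih => rw [pow_succ', Module.End.mul_apply, ih, had, pow_succ', Module.End.mul_apply]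
  have hcomm : Commute ad (LinearMap.mulRight ℤ a) :=
    (LinearMap.commute_mulLeft_right a a).sub_left (Commute.refl _)
  have hsum : LinearMap.mulLeft ℤ a = ad + LinearMap.mulRight ℤ a := by simp [ad]
  have h := congrArg (fun T : Module.End ℤ (Module.End ℤ S) => T (Algebra.lmul ℤ S f))
    (hsum ▸ hcomm.add_pow n : (LinearMap.mulLeft ℤ a) ^ n = _)
  simp only [LinearMap.pow_mulLeft, LinearMap.mulLeft_apply, LinearMap.sum_apply] at h
  rw [h]
  refine Finset.sum_congr rfl fun μ _ => ?_
  rw [(hcomm.pow_pow μ (n - μ)).eq, (Nat.cast_commute (n.choose μ) _).eq.symm,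
    Module.End.mul_apply, Module.End.mul_apply, hadp, LinearMap.pow_mulRight,
    LinearMap.mulRight_apply]
  rw [← nsmul_eq_mul, smul_mul_assoc]
  simp

end Symbols

end Jacobi

/-! ### The brackets realized as a commutator and as a Poisson bracket. -/

section Realization

variable {K : Type*} [CommRing K] [Differential K]
variable {S : Type*} [CommRing S] (D : Derivation ℤ S S) (c : JetRing Idx K →+* S)

theorem map_dOp_pow (hD : ∀ r, D (c r) = c (totalDeriv Idx K r)) (n : ℕ) (r : JetRing Idx K) :
    c ((dOp Idx K ^ n).act r) = (D.toLinearMap ^ n : Module.End ℤ S) (c r) := by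
  induction n with
  | zero => simp
  | succ n ih => rw [dOp_pow_succ_apply, ← hD, ih, pow_succ', Module.End.mul_apply]; rfl

theorem symbolOp_apply (X : Idx →₀ JetRing Idx K) (hD : ∀ r, D (c r) = c (totalDeriv Idx K r))
    (r : JetRing Idx K) :
    symbolOp D c X (c r) = c (X.sum fun
      | .A n, z => z * (dOp Idx K ^ n).act r
      | .phi, _ => 0) := by
  classical
  induction X using Finsupp.induction_linear with
  | zero => simp
  | add X Y hX hY =>
    rw [map_add, LinearMap.add_apply, hX, hY, ← map_add, ← Finsupp.sum_add_index']
    · rintro (n | _) <;> simp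
    · rintro (n | _) a b <;> simp [add_mul]
  | single i z =>
    cases i with
    | A n =>
      rw [symbolOp_single_A, Finsupp.sum_single_index (by simp), map_mul, map_dOp_pow D c hD]
      rfl
    | phi => rw [symbolOp_single_phi, Finsupp.sum_single_index rfl]; simp

/-- Apply the operator to a variable `q_i` that occurs in no coefficient: the jets `q_i^{(n)}` are
independent, and `∂/∂q_i^{(n)}` reads off the `n`-th coefficient. -/
theorem eq_zero_of_symbolOp (hD : ∀ r, D (c r) = c (totalDeriv Idx K r))
    (hc : Function.Injective c) (Z : Idx →₀ JetRing Idx K)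
    (h0 : Z Idx.phi = 0) (h : symbolOp D c Z = 0) : Z = 0 := by
  classical
  have : Infinite Idx := Infinite.of_injective Idx.A fun _ _ h => Idx.A.inj h
  obtain ⟨i, hi⟩ := Infinite.exists_notMem_finset
    (Z.support.biUnion fun j => (Z j).vars.image Prod.fst)
  have hp : ∀ j n, MvPolynomial.pderiv (i, n) (Z j) = 0 := fun j n => by
    by_cases hj : j ∈ Z.support
    · exact MvPolynomial.pderiv_eq_zero_of_notMem_vars fun h =>
        hi (Finset.mem_biUnion.2 ⟨j, hj, Finset.mem_image.2 ⟨_, h, rfl⟩⟩)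
    · rw [Finsupp.notMem_support_iff.1 hj, map_zero]
  have h1 := symbolOp_apply D c Z hD (MvPolynomial.X (i, 0))
  rw [h, LinearMap.zero_apply, ← map_zero c] at h1
  have h2 := hc h1
  ext1 j
  cases j with
  | A n =>
    have h3 := congrArg (MvPolynomial.pderiv (i, n)) h2
    rw [map_zero, Finsupp.sum, map_sum] at h3
    by_contra hn
    rw [Finset.sum_eq_single (Idx.A n)] at h3
    · simp only [dOp_pow_X, Derivation.leibniz, hp, MvPolynomial.pderiv_X_self] at h3
      refine hn ?_
      simpa using h3.symm
    · rintro (m | _) _ hm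
      · have : ((i, m) : Idx × ℕ) ≠ (i, n) := fun h => hm (by rw [(Prod.mk.inj h).2])
        simp only [dOp_pow_X, Derivation.leibniz, hp, MvPolynomial.pderiv_X_of_ne this, smul_zero,
          add_zero]
      · simp
    · intro hm
      exact absurd (Finsupp.notMem_support_iff.1 hm) hn
  | phi => exact h0

theorem symbolOp_jetTerm (hD : ∀ r, D (c r) = c (totalDeriv Idx K r)) (a : K) (k μ : ℕ)
    (z x : JetRing Idx K) :
    symbolOp D c (jetTerm a k μ z x) = Algebra.lmul ℤ S (c z) *
      (Algebra.lmul ℤ S (c (MvPolynomial.C a)) *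
        Algebra.lmul ℤ S ((D.toLinearMap ^ μ : Module.End ℤ S) (c x)) * D.toLinearMap ^ k) := by
  rw [jetTerm_apply, symbolOp_single_A, map_mul c, map_mul c, map_dOp_pow D c hD,
    map_mul (Algebra.lmul ℤ S), mul_comm (c (MvPolynomial.C a)), map_mul (Algebra.lmul ℤ S),
    mul_assoc, mul_assoc, mul_assoc]

theorem lmul_natCast (n : ℕ) :
    Algebra.lmul ℤ S (c (MvPolynomial.C (n : K))) = (n : Module.End ℤ S) := by
  simp

/-- The term `μ = 0` of the Leibniz rule cancels, so the commutator involves `f` only through `D f`.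
With `f = α J(x)` this yields the `φ` column of the KP matrix up to sign. -/
theorem pow_mul_lmul_sub (n : ℕ) (f : S) :
    (D.toLinearMap ^ n : Module.End ℤ S) * Algebra.lmul ℤ S f -
        Algebra.lmul ℤ S f * D.toLinearMap ^ n =
      ∑ s ∈ Finset.range n, (n.choose (s + 1) : Module.End ℤ S) *
        Algebra.lmul ℤ S ((D.toLinearMap ^ s : Module.End ℤ S) (D f)) *
          D.toLinearMap ^ (n - 1 - s) := by
  rw [pow_mul_lmul, Finset.sum_range_succ']
  simp only [Nat.choose_zero_right, Nat.cast_one, one_mul, pow_zero, Module.End.one_apply,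
    Nat.sub_zero, add_sub_cancel_right]
  refine Finset.sum_congr rfl fun s _ => ?_
  rw [pow_succ, Module.End.mul_apply, Nat.sub_sub, add_comm 1 s]
  rfl

theorem symbolOp_kpStar_single (hD : ∀ r, D (c r) = c (totalDeriv Idx K r)) (α : K) (n : ℕ)
    (z : JetRing Idx K) (Y : Idx →₀ JetRing Idx K) :
    symbolOp D c (bilift (kpStar α) (Finsupp.single (Idx.A n) z) Y) =
      Algebra.lmul ℤ S (c z) * (D.toLinearMap ^ n * symbolOp D c Y -
        ∑ s ∈ Finset.range n, Algebra.lmul ℤ S (c (MvPolynomial.C (α * (n.choose (s + 1) : K)))) *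
          Algebra.lmul ℤ S ((D.toLinearMap ^ s : Module.End ℤ S) (c (Y Idx.phi))) *
            D.toLinearMap ^ (n - 1 - s)) := by
  induction Y using Finsupp.induction_linear with
  | zero => simp
  | add X Y hX hY =>
    simp only [map_add, hX, hY, Finsupp.add_apply, mul_add, add_mul, Finset.sum_add_distrib, mul_sub]
    abel
  | single j x =>
    cases j with
    | A m =>
      rw [bilift_single, kpStar]
      simp only [AddMonoidHom.finsetSum_apply, map_sum, symbolOp_jetTerm D c hD,
        symbolOp_single_A, ← mul_assoc (D.toLinearMap ^ n), pow_mul_lmul]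
      simp only [lmul_natCast, Finset.sum_mul, mul_assoc, ← pow_add, ← Finset.mul_sum]
      rw [Finsupp.single_eq_of_ne (by simp)]
      simp only [map_zero, zero_mul, mul_zero, Finset.sum_const_zero, sub_zero]
      congr 1
      refine Finset.sum_congr rfl fun μ hμ => ?_
      rw [Finset.mem_range] at hμ
      rw [show n - μ + m = n + m - μ by omega]
    | phi =>
      rw [bilift_single, kpStar, symbolOp_single_phi, Finsupp.single_eq_same]
      simp only [AddMonoidHom.neg_apply, AddMonoidHom.finsetSum_apply, map_neg, map_sum,
        symbolOp_jetTerm D c hD, ← Finset.mul_sum, mul_zero, zero_sub]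
      exact (mul_neg _ _).symm

/-- The `φ`-part of the product is minus the commutator with multiplication by `α J(Y_φ)`.
Antisymmetrizing gives the commutator of the shifted operators, because multiplication operators
commute among themselves. -/
theorem symbolOp_kpStar {α : K} (hα : α′ = 0) (hD : ∀ r, D (c r) = c (totalDeriv Idx K r))
    (J : JetRing Idx K → S) (hJ : ∀ r, D (J r) = c r) (X Y : Idx →₀ JetRing Idx K) :
    symbolOp D c (bilift (kpStar α) X Y) =
      symbolOp D c X * symbolOp D c Y -
        (symbolOp D c X * Algebra.lmul ℤ S (c (MvPolynomial.C α) * J (Y Idx.phi)) -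
          Algebra.lmul ℤ S (c (MvPolynomial.C α) * J (Y Idx.phi)) * symbolOp D c X) := by
  have hDα : D (c (MvPolynomial.C α)) = 0 := by rw [hD, totalDeriv_C, hα, map_zero, map_zero]
  have hpow : ∀ s f, (D.toLinearMap ^ s : Module.End ℤ S) (c (MvPolynomial.C α) * f) =
      c (MvPolynomial.C α) * (D.toLinearMap ^ s : Module.End ℤ S) f := by
    intro s f
    induction s with
    | zero => simp
    | succ s ih =>
      rw [pow_succ', Module.End.mul_apply, ih, Module.End.mul_apply]
      simp [Derivation.leibniz, hDα]
  induction X using Finsupp.induction_linear with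
  | zero => simp
  | add A B hA hB =>
    rw [map_add (bilift (kpStar α)), AddMonoidHom.add_apply, map_add, hA, hB, map_add]
    noncomm_ring
  | single i z =>
    cases i with
    | A n =>
      rw [symbolOp_kpStar_single D c hD, symbolOp_single_A]
      have h := pow_mul_lmul_sub D n (c (MvPolynomial.C α) * J (Y Idx.phi))
      rw [Derivation.leibniz, hDα, smul_zero, add_zero, hJ, smul_eq_mul] at h
      have e : ∀ v : S, Algebra.lmul ℤ S (c z) * D.toLinearMap ^ n * Algebra.lmul ℤ S v -
          Algebra.lmul ℤ S v * (Algebra.lmul ℤ S (c z) * D.toLinearMap ^ n) =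
          Algebra.lmul ℤ S (c z) * (D.toLinearMap ^ n * Algebra.lmul ℤ S v -
            Algebra.lmul ℤ S v * D.toLinearMap ^ n) := by
        intro v
        rw [mul_sub, mul_assoc, ← mul_assoc (Algebra.lmul ℤ S v), ← map_mul, mul_comm v, map_mul,
          mul_assoc (Algebra.lmul ℤ S (c z)) (Algebra.lmul ℤ S v)]
      rw [e, h, mul_sub, mul_assoc]
      congr 2
      refine Finset.sum_congr rfl fun s _ => ?_
      rw [hpow, map_mul MvPolynomial.C, map_mul c, map_mul, map_mul, lmul_natCast,
        ← (Nat.cast_commute _ _).eq]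
      noncomm_ring
    | phi =>
      have h : bilift (kpStar α) (Finsupp.single Idx.phi z) Y = 0 := by
        induction Y using Finsupp.induction_linear with
        | zero => simp
        | add A B hA hB => rw [map_add, hA, hB, add_zero]
        | single j x => rw [bilift_single, kpStar]; rfl
      rw [h, symbolOp_single_phi]
      simp

-- Here the shift by `α J(Y_φ)` contributes `α Y_φ` through the `x`-derivative; in the other factor
-- no shift is needed, since it is independent of `p`.
open Polynomial in
theorem symbol_benneyStar {α : K} [Differential S] (hα : α′ = 0)
    (hD : ∀ r, (c r)′ = c (totalDeriv Idx K r))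
    (J : JetRing Idx K → S) (hJ : ∀ r, (J r)′ = c r) (X Y : Idx →₀ JetRing Idx K) :
    symbol c (bilift (benneyStar α) X Y) =
      derivative (symbol c X) * Differential.mapCoeffs
        (symbol c Y - C (c (MvPolynomial.C α) * J (Y Idx.phi))) := by
  have hDα : (c (MvPolynomial.C α))′ = 0 := by rw [hD, totalDeriv_C, hα, map_zero, map_zero]
  have hc : Differential.mapCoeffs (C (c (MvPolynomial.C α) * J (Y Idx.phi))) =
      C (c (MvPolynomial.C α) * c (Y Idx.phi)) := by
    rw [Differential.mapCoeffs_C, Derivation.leibniz, hDα, hJ]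
    simp
  rw [map_sub, hc]
  clear hc
  induction X using Finsupp.induction_linear with
  | zero => simp
  | add A B hA hB =>
    rw [map_add (bilift (benneyStar α)), AddMonoidHom.add_apply, map_add, hA, hB,
      map_add (symbol c), map_add derivative]
    ring
  | single i z =>
    induction Y using Finsupp.induction_linear with
    | zero => simp
    | add A B hA hB =>
      rw [map_add (bilift (benneyStar α) _), map_add (symbol c), hA, hB, map_add (symbol c),
        map_add Differential.mapCoeffs, Finsupp.add_apply, map_add c, mul_add, map_add C]
      ring
    | single j x =>
      rw [bilift_single]
      cases i with
      | A n =>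
        cases j with
        | A m =>
          rw [benneyStar, jetTerm_apply, symbol_single_A, symbol_single_A, symbol_single_A,
            Finsupp.single_eq_of_ne (by simp), map_zero, mul_zero, C_0, sub_zero,
            derivative_monomial, Differential.mapCoeffs_monomial, monomial_mul_monomial, pow_one,
            dOp_apply, hD]
          -- For `n = 0` the truncated exponents `n + m - 1` and `n - 1 + m` may differ, but both
          -- coefficients vanish.
          cases n with
          | zero => simp
          | succ n =>
            rw [show n + 1 + m - 1 = n + 1 - 1 + m by omega]
            congr 1
            simp only [map_mul, map_natCast]
            ring
        | phi =>
          rw [benneyStar, AddMonoidHom.neg_apply, AddMonoidHom.neg_apply, jetTerm_apply, map_neg,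
            symbol_single_A, symbol_single_A, symbol_single_phi, Finsupp.single_eq_same, map_zero,
            zero_sub, derivative_monomial, mul_neg, monomial_mul_C, pow_zero, map_one DiffOp.act,
            Module.End.one_apply]
          congr 2
          simp only [map_mul, map_natCast]
          ring
      | phi =>
        rw [benneyStar, symbol_single_phi]
        simp

/-- The commutator bracket of the product given by `s` on single components. -/
def commutatorBracket {M : Type*} [AddCommGroup M] (s : Idx → Idx → M →+ M →+ (Idx →₀ M)) :
    (Idx →₀ M) →+ (Idx →₀ M) →+ (Idx →₀ M) :=
  bilift s - (bilift s).flip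

theorem kp_jacobi_of_antiderivatives {α : K} (hα : α′ = 0)
    (hD : ∀ r, D (c r) = c (totalDeriv Idx K r)) (hc : Function.Injective c)
    (J : JetRing Idx K → S) (hJ0 : J 0 = 0) (hJ : ∀ r, D (J r) = c r)
    (X Y Z : Idx →₀ JetRing Idx K) :
    let br := commutatorBracket (kpStar α)
    br (br Y Z) X - br (br Y X) Z + br (br Z X) Y = 0 := by
  refine jacobi_of_realization _ (fun a b => a * b - b * a) (fun a b c => ?_)
    (symbolOp D c) (fun X => symbolOp D c X -
      Algebra.lmul ℤ _ (c (MvPolynomial.C α) * J (X Idx.phi))) (fun Z h => ?_)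
    (fun X Y => ?_) (fun X Y => ?_) (fun Z h0 h => ?_) X Y Z
  · noncomm_ring
  · simp [h, hJ0]
  · simp [commutatorBracket, bilift_phi_eq_zero _ (kpStar_phi α)]
  · have hcomm : ∀ f g : S,
        Algebra.lmul ℤ _ f * Algebra.lmul ℤ _ g = Algebra.lmul ℤ _ g * Algebra.lmul ℤ _ f :=
      fun f g => by rw [← map_mul, mul_comm, map_mul]
    simp only [commutatorBracket, AddMonoidHom.sub_apply, AddMonoidHom.flip_apply,
      map_sub (symbolOp D c), symbolOp_kpStar D c hα hD J hJ, sub_mul, mul_sub]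
    rw [hcomm (c (MvPolynomial.C α) * J (X Idx.phi))]
    abel
  · exact eq_zero_of_symbolOp D c hD hc Z h0 h

open Polynomial in
theorem benney_jacobi_of_antiderivatives [Differential S] {α : K} (hα : α′ = 0)
    (hD : ∀ r, (c r)′ = c (totalDeriv Idx K r)) (hc : Function.Injective c)
    (J : JetRing Idx K → S) (hJ0 : J 0 = 0) (hJ : ∀ r, (J r)′ = c r)
    (X Y Z : Idx →₀ JetRing Idx K) :
    let br := commutatorBracket (benneyStar α)
    br (br Y Z) X - br (br Y X) Z + br (br Z X) Y = 0 := by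
  have hcomm : ∀ f : S[X],
      Differential.mapCoeffs (derivative f) = derivative (Differential.mapCoeffs f) := by
    intro f
    ext1 n
    simp [coeff_derivative, Derivation.leibniz]
    ring
  refine jacobi_of_realization _ (fun a b => derivative a * Differential.mapCoeffs b -
      derivative b * Differential.mapCoeffs a) (fun a b c => ?_)
    (symbol c) (fun X => symbol c X - C (c (MvPolynomial.C α) * J (X Idx.phi))) (fun Z h => ?_)
    (fun X Y => ?_) (fun X Y => ?_) (fun Z h0 h => ?_) X Y Z
  -- Jacobi identity for the bracket built from the two commuting derivations `∂_p` and `∂_x`.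
  · simp only [map_sub, Derivation.leibniz, derivative_mul, hcomm, smul_eq_mul]
    ring
  · simp [h, hJ0]
  · simp [commutatorBracket, bilift_phi_eq_zero _ (benneyStar_phi α)]
  · simp only [commutatorBracket, AddMonoidHom.sub_apply, AddMonoidHom.flip_apply,
      map_sub (symbol c), symbol_benneyStar c hα hD J hJ, map_sub derivative, derivative_C,
      sub_zero]
  · exact eq_zero_of_symbol c hc Z h0 h

/-! ### Jacobi identities over the jet ring and the conclusion. -/

theorem kp_jacobi {α : K} (hα : α′ = 0) (X Y Z : Idx →₀ JetRing Idx K) :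
    let br := commutatorBracket (kpStar α)
    br (br Y Z) X - br (br Y X) Z + br (br Z X) Y = 0 := by
  obtain ⟨D, J, hD, hJ0, hJ⟩ := exists_antiderivatives (totalDeriv Idx K)
  exact kp_jacobi_of_antiderivatives D _ hα hD (MvPolynomial.C_injective _ _) J hJ0 hJ X Y Z

theorem benney_jacobi {α : K} (hα : α′ = 0) (X Y Z : Idx →₀ JetRing Idx K) :
    let br := commutatorBracket (benneyStar α)
    br (br Y Z) X - br (br Y X) Z + br (br Z X) Y = 0 := by
  obtain ⟨D, J, hD, hJ0, hJ⟩ := exists_antiderivatives (totalDeriv Idx K)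
  let _ : Differential (MvPolynomial (JetRing Idx K) (JetRing Idx K)) := ⟨D⟩
  exact benney_jacobi_of_antiderivatives _ hα hD (MvPolynomial.C_injective _ _) J hJ0 hJ X Y Z

theorem isHamiltonian_of_represents {B : Idx → Idx → DiffOp Idx K}
    {s : Idx → Idx → JetRing Idx K →+ JetRing Idx K →+ (Idx →₀ JetRing Idx K)}
    (h : ∀ i j, Represents (B i j) (fun z x => s i j z x - s j i x z))
    (jacobi : ∀ X Y Z, let br := commutatorBracket s
      br (br Y Z) X - br (br Y X) Z + br (br Z X) Y = 0) : IsHamiltonian B := by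
  have : Infinite Idx := Infinite.of_injective Idx.A fun _ _ h => Idx.A.inj h
  refine isHamiltonian_of_lieBracket B (commutatorBracket s) (fun i j z x => ?_)
    (fun V i j z x => ?_) (fun X Y => ?_) jacobi
  · simp only [(h i j).act, commutatorBracket, AddMonoidHom.sub_apply, AddMonoidHom.flip_apply,
      bilift_single]
  · simp only [(h i j).evol, commutatorBracket, AddMonoidHom.sub_apply, AddMonoidHom.flip_apply,
      bilift_single]
  · simp [commutatorBracket]

end Realization

end DarkEq

end

theorem proposition14p23 {K : Type*} [CommRing K] [Differential K] (α : K) (hα : α′ = 0) :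
    DarkEq.IsHamiltonian (DarkEq.kpExt α) ∧ DarkEq.IsHamiltonian (DarkEq.benneyExt α) :=
  ⟨DarkEq.isHamiltonian_of_represents (DarkEq.represents_kpExt hα) (DarkEq.kp_jacobi hα),
    DarkEq.isHamiltonian_of_represents (DarkEq.represents_benneyExt α) (DarkEq.benney_jacobi hα)⟩
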